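/- Let $G=SL(2,\mathbb C)$ act on $V=\mathbb C^2$ by left multiplication and let $R_d$ ($d\ge 0$) be the space of complex binary forms of degree $d$, i.e. of homogeneous polynomials of degree $d$ on $V$, with the action $(g\cdot p)(v)=p(g^{-1}v)$. Let $G$ act on the dual space $R_d^*$ and on the tensor power $T^m(R_d^*)=(R_d^*)^{\otimes m}$ ($m\ge 0$), whose elements are identified with $m$-linear forms on $R_d$, in the induced way. Let $T^m(R_d^*)^G$ be the space of invariants. For $F\in T^m(R_d^*)$ let its symbol be the function $\tilde\omega_F$ on $(V^*)^m$ given by $$\tilde\omega_F(y_1,\dots,y_m)=F(y_1^d,\dots,y_m^d),$$ where $y_i^d\in R_d$ is the polynomial $v\mapsto y_i(v)^d$. For $y,z\in V^*$ put $[y\,z]=y(e_1)z(e_2)-y(e_2)z(e_1)$, where $e_1,e_2$ is the standard basis of $V$. A pair partition of $[md]=\{1,\dots,md\}$ is a set partition all of whose blocks have exactly two elements. A set partition $\pi$ of $[md]$ is $m$-partite if no block contains two distinct elements of the same interval $I_k=\{(k-1)d+1,\dots,kd\}$, $1\le k\le m$, and noncrossing if there are no $i<i'<j<j'$ such that $i,j$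 lie in one block and $i',j'$ lie in a different block. To an $m$-partite pair partition $\pi$ of $[md]$ associate the symbol $$\tilde\omega_\pi(y_1,\dots,y_m)=\prod_{\{i<j\}\in\pi}[y_{k(i)}\;y_{k(j)}],$$ where $k(i)$ is the index with $i\in I_{k(i)}$. Then for all integers $m,d\ge 0$ the dimension of $T^m(R_d^*)^G$ equals the number of $m$-partite noncrossing pair partitions of $[md]$. Moreover, the symbols $\tilde\omega_\pi$ of these partitions are linearly independent and form a basis of the space $\{\tilde\omega_F : F\in T^m(R_d^*)^G\}$, and there is a basis $(F_\pi)$ of $T^m(R_d^*)^G$, indexed by these partitions, with $\tilde\omega_{F_\pi}=\tilde\omega_\pi$ for every $\pi$. -/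

import Mathlib

open scoped TensorProduct

namespace BinaryForms

noncomputable section

/-- The group `SL(2, ℂ)`. -/
abbrev G : Type := Matrix.SpecialLinearGroup (Fin 2) ℂ

/-- The plane `V = ℂ²`, with standard basis `e₁ = Pi.single 0 1`, `e₂ = Pi.single 1 1`. -/
abbrev V : Type := Fin 2 → ℂ

/-- The space `R_d` of binary forms of degree `d`, i.e. of `d`-homogeneous polynomials on `V`;
the variables `X 0`, `X 1` are the standard coordinates on `V`. -/
abbrev Form (d : ℕ) : Type := MvPolynomial.homogeneousSubmodule (Fin 2) ℂ d

/-- The substitution `p(v) ↦ p(g⁻¹ v)` on polynomials on `V`. -/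
def substAlgHom (g : G) : MvPolynomial (Fin 2) ℂ →ₐ[ℂ] MvPolynomial (Fin 2) ℂ :=
  MvPolynomial.aeval fun i =>
    ∑ j, MvPolynomial.C ((g⁻¹ : G).1 i j) * MvPolynomial.X j

/-- The defining property of the induced action: `(g · p)(v) = p(g⁻¹ v)`. -/
theorem eval_substAlgHom (g : G) (p : MvPolynomial (Fin 2) ℂ) (v : V) :
    MvPolynomial.eval v (substAlgHom g p) =
      MvPolynomial.eval (Matrix.mulVec (g⁻¹ : G).1 v) p := by
  induction p using MvPolynomial.induction_on with
  | C a => simp [substAlgHom, MvPolynomial.algebraMap_eq]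
  | add p q hp hq => simp only [map_add, hp, hq]
  | mul_X p i hp =>
    rw [map_mul, map_mul, map_mul, hp, MvPolynomial.eval_X, substAlgHom, MvPolynomial.aeval_X,
      map_sum]
    simp only [map_mul, MvPolynomial.eval_C, MvPolynomial.eval_X, Matrix.mulVec, dotProduct]

theorem substAlgHom_isHomogeneous (g : G) {d : ℕ} {p : MvPolynomial (Fin 2) ℂ}
    (hp : p.IsHomogeneous d) : (substAlgHom g p).IsHomogeneous d := by
  have h := hp.aeval (n := 1)
    (fun i => ∑ j, MvPolynomial.C ((g⁻¹ : G).1 i j) * MvPolynomial.X j) (fun i => by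
      refine MvPolynomial.IsHomogeneous.sum _ _ _ fun j _ => ?_
      simpa using (MvPolynomial.isHomogeneous_C (Fin 2) ((g⁻¹ : G).1 i j)).mul
        (MvPolynomial.isHomogeneous_X ℂ j))
  simpa [substAlgHom] using h

/-- The representation of `SL(2, ℂ)` on `R_d`, `(g · p)(v) = p(g⁻¹ v)`. -/
def formRep (d : ℕ) : Representation ℂ G (Form d) where
  toFun g := (substAlgHom g).toLinearMap.restrict fun _ hp => substAlgHom_isHomogeneous g hp
  map_one' := by
    refine LinearMap.ext fun p => Subtype.ext (MvPolynomial.funext fun v => ?_)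
    change MvPolynomial.eval v (substAlgHom 1 p.1) = MvPolynomial.eval v p.1
    rw [eval_substAlgHom]
    simp
  map_mul' g h := by
    refine LinearMap.ext fun p => Subtype.ext (MvPolynomial.funext fun v => ?_)
    change MvPolynomial.eval v (substAlgHom (g * h) p.1) =
      MvPolynomial.eval v (substAlgHom g (substAlgHom h p.1))
    rw [eval_substAlgHom, eval_substAlgHom, eval_substAlgHom, Matrix.mulVec_mulVec, mul_inv_rev,
      Matrix.SpecialLinearGroup.coe_mul]

/-- `T^m(R_d^*)`, the noncommutative polynomials of degree `m` in the coefficients of a binary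
form of degree `d`. -/
abbrev NCPoly (m d : ℕ) : Type := ⨂[ℂ] _ : Fin m, Module.Dual ℂ (Form d)

/-- The `m`-fold tensor power of the dual of the representation on `R_d`. -/
def tensorRep (m d : ℕ) : Representation ℂ G (NCPoly m d) where
  toFun g := PiTensorProduct.map fun _ => (formRep d).dual g
  map_one' := by simp only [map_one]; exact PiTensorProduct.map_one
  map_mul' g h := by simp only [map_mul]; exact PiTensorProduct.map_mul _ _

/-- `T^m(R_d^*)^G`. -/
abbrev invariantPolys (m d : ℕ) : Submodule ℂ (NCPoly m d) := (tensorRep m d).invariants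

/-- The value of `F ∈ T^m(R_d^*)`, seen as an `m`-linear form on `R_d`:
`(f₁ ⊗ ⋯ ⊗ fₘ)(p₁, …, pₘ) = f₁(p₁) ⋯ fₘ(pₘ)`. -/
def evalForms {m d : ℕ} (F : NCPoly m d) (p : Fin m → Form d) : ℂ :=
  PiTensorProduct.dualDistrib F (PiTensorProduct.tprod ℂ p)

/-- A linear form `y ∈ V^*` as a polynomial, `y(e₁) X + y(e₂) Y`. -/
def linearPoly (y : Module.Dual ℂ V) : MvPolynomial (Fin 2) ℂ :=
  ∑ i, MvPolynomial.C (y (Pi.single i 1)) * MvPolynomial.X i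

theorem linearPoly_isHomogeneous (y : Module.Dual ℂ V) : (linearPoly y).IsHomogeneous 1 := by
  refine MvPolynomial.IsHomogeneous.sum _ _ _ fun i _ => ?_
  simpa using (MvPolynomial.isHomogeneous_C (Fin 2) (y (Pi.single i 1))).mul
    (MvPolynomial.isHomogeneous_X ℂ i)

/-- The symmetrization of `y₁ ⊗ ⋯ ⊗ y_d ∈ T^d(V^*)` as an element of `R_d ≅ S^d(V^*)`.
The symmetric `d`-linear form `(1/d!) ∑_σ ∏ j, y_{σ j}(v_j)` corresponds to the polynomial
obtained by setting all `v_j = v`, which is `v ↦ ∏ j, y_j(v)`. -/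
def symmProd {d : ℕ} (y : Fin d → Module.Dual ℂ V) : Form d :=
  ⟨∏ j, linearPoly (y j), by
    simpa using MvPolynomial.IsHomogeneous.prod Finset.univ (fun j => linearPoly (y j))
      (fun _ => 1) fun j _ => linearPoly_isHomogeneous (y j)⟩

theorem eval_symmProd {d : ℕ} (y : Fin d → Module.Dual ℂ V) (v : V) :
    MvPolynomial.eval v (symmProd y).1 = ∏ j, y j v := by
  change MvPolynomial.eval v (∏ j, linearPoly (y j)) = _
  rw [map_prod]
  refine Finset.prod_congr rfl fun j _ => ?_
  conv_rhs => rw [pi_eq_sum_univ' v, map_sum]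
  simp [linearPoly, mul_comm, Pi.single]

/-- The symbol `ω_F` of `F`, an `md`-linear form on `V^*`. -/
def symbol {m d : ℕ} (F : NCPoly m d) (y : Fin m → Fin d → Module.Dual ℂ V) : ℂ :=
  evalForms F fun i => symmProd (y i)

/-- `ω̃_F(y₁, …, yₘ) = ω_F(y₁, …, y₁, …, yₘ, …, yₘ)`, as a linear map `F ↦ ω̃_F` into functions
on `(V^*)^m`. -/
def diagSymbol (m d : ℕ) : NCPoly m d →ₗ[ℂ] ((Fin m → Module.Dual ℂ V) → ℂ) where
  toFun F y := symbol F fun i _ => y i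
  map_add' F F' := by ext y; simp [symbol, evalForms]
  map_smul' c F := by ext y; simp [symbol, evalForms]

/-- The bracket `[y z]` on `V^*`. -/
def bracket (y z : Module.Dual ℂ V) : ℂ :=
  Matrix.det !![y (Pi.single 0 1), z (Pi.single 0 1); y (Pi.single 1 1), z (Pi.single 1 1)]

/-- Set partitions of an `n`-element linearly ordered set. -/
abbrev SetPartition (n : ℕ) : Type := Finpartition (Finset.univ : Finset (Fin n))

/-- `i ∼_π j`: the points `i` and `j` lie in a common block of `π`. -/
def Rel {n : ℕ} (π : SetPartition n) (i j : Fin n) : Prop :=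
  ∃ B ∈ π.parts, i ∈ B ∧ j ∈ B

/-- `π` has no crossing `i < i' < j < j'` with `i ∼ j`, `i' ∼ j'`, `i ≁ i'`. -/
def IsNoncrossing {n : ℕ} (π : SetPartition n) : Prop :=
  ¬ ∃ i i' j j' : Fin n, i < i' ∧ i' < j ∧ j < j' ∧ Rel π i j ∧ Rel π i' j' ∧ ¬ Rel π i i'

/-- All blocks of `π` have exactly two elements. -/
def IsPairPartition {n : ℕ} (π : SetPartition n) : Prop :=
  ∀ B ∈ π.parts, B.card = 2

/-- No block of `π` contains two elements of the same length-`d` interval;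
`i.divNat : Fin m` is the number of the interval that contains `i : Fin (m * d)`. -/
def IsMPartite {m d : ℕ} (π : SetPartition (m * d)) : Prop :=
  ∀ B ∈ π.parts, ∀ i ∈ B, ∀ j ∈ B, i.divNat = j.divNat → i = j

/-- The `m`-partite noncrossing pair partitions of `[md]`. -/
def NCPairing (m d : ℕ) : Type :=
  {π : SetPartition (m * d) // IsPairPartition π ∧ IsMPartite π ∧ IsNoncrossing π}

open Classical in
/-- The symbol `ω̃_π(y₁, …, yₘ) = ∏ [y_i y_j]` of a pair partition `π`, the product being over the
blocks `{i < j}` of `π`, where `y_i` is the variable attached to the interval that contains `i`. -/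
def pairingSymbol {m d : ℕ} (π : SetPartition (m * d)) (y : Fin m → Module.Dual ℂ V) : ℂ :=
  ∏ e : Fin (m * d) × Fin (m * d) with e.1 < e.2 ∧ Rel π e.1 e.2,
    bracket (y e.1.divNat) (y e.2.divNat)

end

end BinaryForms

/-!
Restrict the symbol of `F` to the linear forms `y_k = (x_k, 1)`. It becomes a polynomial in
`x_1, …, x_m` of degree at most `d` in each variable (`affineSymbol`), every such polynomial arises
from exactly one `F`, and the bracket `[y_k y_l]` becomes `x_k - x_l`. If `F` is invariant, the
unipotent matrices make this polynomial invariant under translations `x ↦ x + t`, and a diagonal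
matrix makes it homogeneous of degree `md / 2` (`isInvariant_affineSymbol`). The core of the proof
is that the polynomials with these properties have as a basis the products
`∏ (x_{k(i)} - x_{k(j)})` over the pairs of a noncrossing `m`-partite matching. Since these products
come from brackets, which are invariant under the whole group, the theorem follows.

The core is proved for an arbitrary finite set `S` of points in a linear order with a monotone
colouring `c`, the degree in `x_k` being bounded by the number of points of colour `k`. If two
neighbours `p < q` in `S` have different colours, a noncrossing matching of `S` without
monochromatic pairs either has no pair joining the colours of `p` and `q`, so that it is still
allowed after merging these two colours, or it matches `p` with `q`, and arises from a matching of
the set `S` without `p` and `q` (`isMatching_merge_iff`, `sum_matchings`). On the side of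
polynomials, identifying the variables `x_{c p}` and `x_{c q}` maps the invariants of `S` to those
of `S` with merged colours, and its kernel consists of the multiples of `x_{c p} - x_{c q}`, the
quotients being invariants of the smaller point set (`IsInvariant.of_X_sub_X_mul`). So linear
independence (`linearIndependent_diffProd`) and spanning (`IsInvariant.exists_eq_sum`) both follow
by induction (`colored_induction`). When there is only one colour, a translation-invariant
polynomial is constant, and vanishes by homogeneity unless `S` is empty.
-/

namespace BinaryForms

open MvPolynomial Finset

/-! ### Noncrossing matchings of coloured points -/

section Matchings

variable {P K : Type*} [LinearOrder P]

/-- A noncrossing matching of the points of `S`, no two points of the same colour being matched.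
It is encoded as an involution `σ` of the ambient ordered set `P` that moves exactly the points
of `S`, so that deleting points from `S` requires no relabelling. -/
structure IsMatching (S : Finset P) (c : P → K) (σ : P → P) : Prop where
  invol : ∀ i, σ (σ i) = i
  mem_iff : ∀ i, i ∈ S ↔ σ i ≠ i
  color : ∀ i ∈ S, c (σ i) ≠ c i
  nested : ∀ i j, i < j → j < σ i → σ j ≤ σ i

open Classical in
/-- The finite set of all noncrossing matchings of `S` with respect to the colouring `c`. -/
noncomputable def matchings [Fintype P] (S : Finset P) (c : P → K) : Finset (P → P) :=
  {σ | IsMatching S c σ}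

@[simp]
theorem mem_matchings [Fintype P] {S : Finset P} {c : P → K} {σ : P → P} :
    σ ∈ matchings S c ↔ IsMatching S c σ := by
  simp [matchings]

namespace IsMatching

variable {S : Finset P} {c : P → K} {σ : P → P}

theorem map_mem (h : IsMatching S c σ) {i : P} (hi : i ∈ S) : σ i ∈ S := by
  rw [h.mem_iff] at hi ⊢
  rw [h.invol]
  exact hi.symm

theorem eq_self (h : IsMatching S c σ) {i : P} (hi : i ∉ S) : σ i = i := by
  by_contra h'
  exact hi ((h.mem_iff i).2 h')

theorem injective (h : IsMatching S c σ) : Function.Injective σ := fun i j hij => by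
  rw [← h.invol i, hij, h.invol]

/-- The partner of a point lying strictly under an arc lies strictly under that arc. -/
theorem lt_of_nested (h : IsMatching S c σ) {i j : P} (hij : i < j) (hj : j < σ i) :
    i < σ j ∧ σ j < σ i := by
  have hne : σ j ≠ σ i := fun e => hij.ne' (h.injective e)
  refine ⟨?_, lt_of_le_of_ne (h.nested i j hij hj) hne⟩
  rcases lt_trichotomy (σ j) i with hlt | heq | hgt
  · have := h.nested (σ j) i hlt (by rw [h.invol]; exact hij)
    rw [h.invol] at this
    exact absurd hj this.not_gt
  · rw [← heq, h.invol] at hj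
    exact absurd hj (lt_irrefl _)
  · exact hgt

/-- A product over the matched points, arranged by pairs. -/
@[to_additive]
theorem prod_pairs [Fintype P] {M : Type*} [CommMonoid M] (h : IsMatching S c σ) (g : P → M) :
    ∏ i with i < σ i, (g i * g (σ i)) = ∏ i ∈ S, g i := by
  have h1 : ∏ i with i < σ i, g (σ i) = ∏ i with σ i < i, g i :=
    Finset.prod_nbij' σ σ (by simp [h.invol]) (by simp [h.invol]) (by simp [h.invol])
      (by simp [h.invol]) (by simp)
  have h2 : S = ({i | i < σ i} : Finset P) ∪ ({i | σ i < i} : Finset P) := by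
    ext i
    simp only [mem_union, mem_filter, mem_univ, true_and, h.mem_iff]
    exact ⟨fun e => (lt_or_gt_of_ne e.symm), fun e => e.elim (fun e => e.ne') fun e => e.ne⟩
  rw [Finset.prod_mul_distrib, h1, h2, Finset.prod_union]
  rw [Finset.disjoint_filter]
  exact fun i _ h3 h4 => lt_asymm h3 h4

end IsMatching

/-- `q` is the successor of `p` in `S`. -/
structure IsNext (S : Finset P) (p q : P) : Prop where
  left : p ∈ S
  right : q ∈ S
  lt : p < q
  le_or_le : ∀ i ∈ S, i ≤ p ∨ q ≤ i

section Next

variable {S : Finset P} {c : P → K} {p q : P}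

/-- Matching two neighbouring points `p`, `q` of different colours with each other does not create
crossings. -/
theorem IsMatching.swap_comp {τ : P → P} (hpq : IsNext S p q) (hc : c p ≠ c q)
    (h : IsMatching ((S.erase p).erase q) c τ) : IsMatching S c (Equiv.swap p q ∘ τ) := by
  have hp : τ p = p := h.eq_self (by simp)
  have hq : τ q = q := h.eq_self (by simp)
  have hne := hpq.lt.ne
  have hp' : ∀ i, i ≠ p → τ i ≠ p := fun i hi e => hi (h.injective (e.trans hp.symm))
  have hq' : ∀ i, i ≠ q → τ i ≠ q := fun i hi e => hi (h.injective (e.trans hq.symm))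
  have hp'' : (Equiv.swap p q ∘ τ) p = q := by simp [hp]
  have hq'' : (Equiv.swap p q ∘ τ) q = p := by simp [hq]
  have ho : ∀ i, i ≠ p → i ≠ q → (Equiv.swap p q ∘ τ) i = τ i := fun i h1 h2 =>
    Equiv.swap_apply_of_ne_of_ne (hp' i h1) (hq' i h2)
  have hS : ∀ i, i ≠ p → i ≠ q → τ i ≠ i → τ i ∈ S := fun i h1 h2 h3 => by
    have := h.map_mem ((h.mem_iff i).2 h3)
    simp only [mem_erase] at this
    exact this.2.2
  constructor
  · intro i
    by_cases h1 : i = p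
    · rw [h1, hp'', hq'']
    by_cases h2 : i = q
    · rw [h2, hq'', hp'']
    rw [ho i h1 h2, ho _ (hp' i h1) (hq' i h2), h.invol]
  · intro i
    by_cases h1 : i = p
    · rw [h1, hp'']; simp [hpq.left, hne.symm]
    by_cases h2 : i = q
    · rw [h2, hq'']; simp [hpq.right, hne]
    rw [ho i h1 h2, ← h.mem_iff]
    simp [h1, h2]
  · intro i hi
    by_cases h1 : i = p
    · rw [h1, hp'']; exact hc.symm
    by_cases h2 : i = q
    · rw [h2, hq'']; exact hc
    rw [ho i h1 h2]
    exact h.color i (by simp [h1, h2, hi])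
  · intro i j hij hj
    by_cases h1 : i = p
    · subst h1
      rw [hp''] at hj ⊢
      have h3 : j ∉ S := fun hjS => (hpq.le_or_le j hjS).elim hij.not_ge hj.not_ge
      rw [ho j hij.ne' hj.ne, h.eq_self (by simp [h3])]
      exact hj.le
    by_cases h2 : i = q
    · subst h2
      rw [hq''] at hj
      exact absurd (hij.trans hj) hpq.lt.not_gt
    rw [ho i h1 h2] at hj ⊢
    have h4 := hS i h1 h2 (hij.trans hj).ne'
    by_cases h1' : j = p
    · rw [h1', hp'']
      exact (hpq.le_or_le _ h4).resolve_left (h1' ▸ hj).not_ge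
    by_cases h2' : j = q
    · rw [h2', hq'']
      exact hpq.lt.le.trans (h2' ▸ hj.le)
    rw [ho j h1' h2']
    exact h.nested i j hij hj

/-- The converse of `IsMatching.swap_comp`: an arc between neighbouring points can be removed. -/
theorem IsMatching.swap_comp_erase {σ : P → P} (h : IsMatching S c σ)
    (hσ : σ p = q) : IsMatching ((S.erase p).erase q) c (Equiv.swap p q ∘ σ) := by
  have hσ' : σ q = p := by rw [← hσ, h.invol]
  have hp' : ∀ i, i ≠ q → σ i ≠ p := fun i hi e => hi (h.injective (e.trans hσ'.symm))
  have hq' : ∀ i, i ≠ p → σ i ≠ q := fun i hi e => hi (h.injective (e.trans hσ.symm))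
  have hp'' : (Equiv.swap p q ∘ σ) p = p := by simp [hσ]
  have hq'' : (Equiv.swap p q ∘ σ) q = q := by simp [hσ']
  have ho : ∀ i, i ≠ p → i ≠ q → (Equiv.swap p q ∘ σ) i = σ i := fun i h1 h2 =>
    Equiv.swap_apply_of_ne_of_ne (hp' i h2) (hq' i h1)
  constructor
  · intro i
    by_cases h1 : i = p
    · rw [h1, hp'', hp'']
    by_cases h2 : i = q
    · rw [h2, hq'', hq'']
    rw [ho i h1 h2, ho _ (hp' i h2) (hq' i h1), h.invol]
  · intro i
    by_cases h1 : i = p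
    · rw [h1, hp'']; simp
    by_cases h2 : i = q
    · rw [h2, hq'']; simp
    rw [ho i h1 h2, ← h.mem_iff]
    simp [h1, h2]
  · intro i hi
    simp only [mem_erase] at hi
    rw [ho i hi.2.1 hi.1]
    exact h.color i hi.2.2
  · intro i j hij hj
    by_cases h1 : i = p
    · rw [h1, hp''] at hj
      exact absurd (h1 ▸ hij) hj.not_gt
    by_cases h2 : i = q
    · rw [h2, hq''] at hj
      exact absurd (h2 ▸ hij) hj.not_gt
    rw [ho i h1 h2] at hj ⊢
    by_cases h1' : j = p
    · rw [h1', hp'']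
      exact h1' ▸ hj.le
    by_cases h2' : j = q
    · rw [h2', hq'']
      exact h2' ▸ hj.le
    rw [ho j h1' h2']
    exact h.nested i j hij hj

end Next

section Merge

variable [LinearOrder K] {S : Finset P} {c : P → K} {p q : P}

/-- The map of colours that replaces the colour `b` by `a`. -/
def merge (a b : K) (k : K) : K := if k = b then a else k

/-- If some arc joins the colours of the neighbours `p` and `q`, then the innermost such arc joins
`p` to `q`. -/
theorem IsMatching.apply_eq_of_color {σ : P → P} (h : IsMatching S c σ)
    (hmono : MonotoneOn c S) (hpq : IsNext S p q) (hc : c p ≠ c q)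
    (hi : ∃ i ∈ S, c i = c p ∧ c (σ i) = c q) : σ p = q := by
  have hlt : c p < c q := lt_of_le_of_ne (hmono hpq.left hpq.right hpq.lt.le) hc
  have hle : ∀ i ∈ S, c i = c p → i ≤ p := fun i hi e => by
    refine (hpq.le_or_le i hi).resolve_right fun hqi => ?_
    have := hmono hpq.right hi hqi
    exact absurd (hlt.trans_le this) (by rw [e]; exact lt_irrefl _)
  have hge : ∀ i ∈ S, c i = c q → q ≤ i := fun i hi e => by
    refine (hpq.le_or_le i hi).resolve_left fun hip => ?_
    have := hmono hi hpq.left hip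
    exact absurd (hlt.trans_le (e ▸ this)) (lt_irrefl _)
  set T := S.filter fun i => c i = c p ∧ c (σ i) = c q with hT
  have hTne : T.Nonempty := by
    obtain ⟨i, hi, hi'⟩ := hi
    exact ⟨i, by simp [hT, hi, hi']⟩
  set i := T.max' hTne
  have hiT : i ∈ T := T.max'_mem hTne
  obtain ⟨hiS, hic, hiσ⟩ := mem_filter.1 hiT
  have hip := hle i hiS hic
  have hiq := hge _ (h.map_mem hiS) hiσ
  -- every point under the arc of `i` has one of the two colours
  have hbetween : ∀ j ∈ S, i ≤ j → j ≤ σ i → c j = c p ∨ c j = c q := fun j hj h1 h2 => by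
    rcases hpq.le_or_le j hj with h3 | h3
    · exact .inl (le_antisymm (hmono hj hpq.left h3) (hic ▸ hmono hiS hj h1))
    · exact .inr (le_antisymm (hiσ ▸ hmono hj (h.map_mem hiS) h2) (hmono hpq.right hj h3))
  have hip' : i = p := by
    by_contra hne
    have hlt' : i < p := lt_of_le_of_ne hip hne
    obtain ⟨h1, h2⟩ := h.lt_of_nested hlt' (hpq.lt.trans_le hiq)
    have h3 := (hbetween _ (h.map_mem hpq.left) h1.le h2.le).resolve_left (h.color p hpq.left)
    have h4 : p ∈ T := by simp [hT, hpq.left, h3]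
    exact absurd (T.le_max' p h4) hlt'.not_ge
  rw [hip'] at hiq hbetween
  by_contra hne
  have hlt' : q < σ p := lt_of_le_of_ne hiq (Ne.symm hne)
  obtain ⟨h1, h2⟩ := h.lt_of_nested hpq.lt hlt'
  have h3 := (hbetween _ (h.map_mem hpq.right) h1.le h2.le).resolve_right (h.color q hpq.right)
  exact absurd (hle _ (h.map_mem hpq.right) h3) h1.not_ge

theorem isMatching_merge_iff {σ : P → P} (hmono : MonotoneOn c S) (hpq : IsNext S p q)
    (hc : c p ≠ c q) :
    IsMatching S (merge (c p) (c q) ∘ c) σ ↔ IsMatching S c σ ∧ σ p ≠ q := by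
  constructor
  · intro h
    refine ⟨⟨h.invol, h.mem_iff, fun i hi e => h.color i hi (by simp [e]), h.nested⟩, fun e => ?_⟩
    have := h.color p hpq.left
    simp [merge, e, hc] at this
  · rintro ⟨h, hσ⟩
    refine ⟨h.invol, h.mem_iff, fun i hi e => ?_, h.nested⟩
    have hcol := h.color i hi
    simp only [Function.comp_apply, merge] at e
    split_ifs at e with h1 h2 h2
    · exact hcol (h1.trans h2.symm)
    · exact hσ (h.apply_eq_of_color hmono hpq hc ⟨i, hi, e.symm, h1⟩)
    · exact hσ (h.apply_eq_of_color hmono hpq hc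
        ⟨σ i, h.map_mem hi, e, by rw [h.invol]; exact h2⟩)
    · exact hcol e

theorem monotoneOn_merge (hmono : MonotoneOn c S) (hpq : IsNext S p q) :
    MonotoneOn (merge (c p) (c q) ∘ c) S := by
  intro i hi j hj hij
  have h1 := hmono hi hj hij
  simp only [Function.comp_apply, merge]
  split_ifs with h2 h3 h3
  · exact le_rfl
  · exact (hmono hpq.left hpq.right hpq.lt.le).trans (h2 ▸ h1)
  · rcases hpq.le_or_le i hi with h4 | h4
    · exact hmono hi hpq.left h4
    · exact absurd (le_antisymm (h3 ▸ h1) (hmono hpq.right hi h4)) h2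
  · exact h1

theorem card_image_merge_lt (hpq : IsNext S p q) (hc : c p ≠ c q) :
    (S.image (merge (c p) (c q) ∘ c)).card < (S.image c).card := by
  refine Finset.card_lt_card ((Finset.ssubset_iff_of_subset ?_).2
    ⟨c q, mem_image_of_mem c hpq.right, ?_⟩)
  · intro k hk
    obtain ⟨i, hi, rfl⟩ := mem_image.1 hk
    simp only [Function.comp_apply, merge]
    split_ifs
    · exact mem_image_of_mem c hpq.left
    · exact mem_image_of_mem c hi
  · intro hk
    obtain ⟨i, -, hi⟩ := mem_image.1 hk
    simp only [Function.comp_apply, merge] at hi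
    split_ifs at hi with h1
    · exact hc hi
    · exact h1 hi

/-- If `S` has points of different colours, then so do some two neighbours: take for `q` the first
point whose colour is not that of the minimum. -/
theorem exists_isNext (h : ¬ ∀ i ∈ S, ∀ j ∈ S, c i = c j) :
    ∃ p q, IsNext S p q ∧ c p ≠ c q := by
  push Not at h
  obtain ⟨i, hi, j, hj, hij⟩ := h
  set m := S.min' ⟨i, hi⟩
  have hm : m ∈ S := S.min'_mem _
  have hT : (S.filter fun x => c x ≠ c m).Nonempty := by
    by_cases h1 : c i = c m
    · exact ⟨j, by simp only [mem_filter]; exact ⟨hj, fun e => hij (h1.trans e.symm)⟩⟩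
    · exact ⟨i, by simp [hi, h1]⟩
  set q := (S.filter fun x => c x ≠ c m).min' hT
  have hq := (S.filter fun x => c x ≠ c m).min'_mem hT
  rw [mem_filter] at hq
  have hmq : m < q := lt_of_le_of_ne (S.min'_le q hq.1) fun e => hq.2 (congrArg c e).symm
  have hU : (S.filter fun x => x < q).Nonempty := ⟨m, by simp [hm, hmq]⟩
  set p := (S.filter fun x => x < q).max' hU
  have hp := (S.filter fun x => x < q).max'_mem hU
  rw [mem_filter] at hp
  refine ⟨p, q, ⟨hp.1, hq.1, hp.2, fun x hx => ?_⟩, fun e => ?_⟩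
  · rcases lt_or_ge x q with h1 | h1
    · exact .inl (Finset.le_max' _ _ (by simp [hx, h1]))
    · exact .inr h1
  · exact absurd (Finset.min'_le (S.filter fun x => c x ≠ c m) p
      (by rw [mem_filter]; exact ⟨hp.1, e ▸ hq.2⟩)) hp.2.not_ge

/-- The induction underlying the argument: a statement about coloured point sets holds in general
if it holds for a single colour and can be deduced from the two point sets obtained by merging the
colours of two neighbours, respectively by deleting these neighbours. -/
theorem colored_induction {Q : Finset P → (P → K) → Prop}
    (base : ∀ (S : Finset P) c, (∀ i ∈ S, ∀ j ∈ S, c i = c j) → Q S c)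
    (step : ∀ (S : Finset P) c p q, MonotoneOn c S → IsNext S p q → c p ≠ c q →
      Q S (merge (c p) (c q) ∘ c) → Q ((S.erase p).erase q) c → Q S c)
    (S : Finset P) (c : P → K) (hc : MonotoneOn c S) : Q S c := by
  induction hn : S.card + (S.image c).card using Nat.strong_induction_on generalizing S c with
  | _ n ih =>
    by_cases h : ∀ i ∈ S, ∀ j ∈ S, c i = c j
    · exact base S c h
    obtain ⟨p, q, hpq, hcpq⟩ := exists_isNext h
    have hsub : (S.erase p).erase q ⊆ S := (erase_subset _ _).trans (erase_subset _ _)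
    refine step S c p q hc hpq hcpq (ih _ ?_ S _ (monotoneOn_merge hc hpq) rfl)
      (ih _ ?_ _ c (hc.mono (by exact_mod_cast hsub)) rfl)
    · have := card_image_merge_lt hpq hcpq
      omega
    · have h1 : ((S.erase p).erase q).card < S.card := card_lt_card
        ((ssubset_iff_of_subset hsub).2 ⟨p, hpq.left, by simp⟩)
      have h2 := card_le_card (image_subset_image (f := c) hsub)
      omega

end Merge

end Matchings

/-! ### Translation-invariant polynomials and differences of variables -/

section Polynomials

variable {P K : Type*}

/-- The product `∏ (X_{c i} - X_{c j})` over the pairs `i < j` matched by `σ`: the symbol of the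
matching, restricted to the linear forms `y_k = (x_k, 1)`. -/
noncomputable def diffProd [LinearOrder P] [Fintype P] (c : P → K) (σ : P → P) : MvPolynomial K ℂ :=
  ∏ i with i < σ i, (X (c i) - X (c (σ i)))

/-- The translation `f(x) ↦ f(x + t)`. -/
noncomputable def translate (t : ℂ) : MvPolynomial K ℂ →ₐ[ℂ] MvPolynomial K ℂ :=
  aeval fun k => X k + C t

/-- The dilation `f(x) ↦ f(4 x)`, by which the diagonal matrix with entries `2`, `1/2` acts on the
points `(x, 1)` up to a scalar. -/
noncomputable def dilate : MvPolynomial K ℂ →ₐ[ℂ] MvPolynomial K ℂ :=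
  aeval fun k => C 4 * X k

theorem eval_translate (t : ℂ) (x : K → ℂ) (f : MvPolynomial K ℂ) :
    eval x (translate t f) = eval (fun k => x k + t) f := by
  induction f using MvPolynomial.induction_on with
  | C a => simp [translate, algebraMap_eq]
  | add p q hp hq => simp only [map_add, hp, hq]
  | mul_X p i hp => rw [map_mul, map_mul, map_mul, hp]; simp [translate]

theorem eval_dilate (x : K → ℂ) (f : MvPolynomial K ℂ) :
    eval x (dilate f) = eval (fun k => 4 * x k) f := by
  induction f using MvPolynomial.induction_on with
  | C a => simp [dilate, algebraMap_eq]
  | add p q hp hq => simp only [map_add, hp, hq]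
  | mul_X p i hp => rw [map_mul, map_mul, map_mul, hp]; simp [dilate]

theorem translate_X_sub_X (t : ℂ) (k l : K) :
    translate t (X k - X l) = (X k - X l : MvPolynomial K ℂ) := by
  simp [translate]

theorem dilate_X_sub_X (k l : K) :
    dilate (X k - X l) = (C (2 * 2) * (X k - X l) : MvPolynomial K ℂ) := by
  simp only [dilate, map_sub, aeval_X, mul_sub]
  norm_num

theorem rename_translate {L : Type*} (ρ : K → L) (t : ℂ) (f : MvPolynomial K ℂ) :
    translate t (rename ρ f) = rename ρ (translate t f) := by
  have : (translate t).comp (rename ρ) = (rename ρ).comp (translate (K := K) t) :=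
    MvPolynomial.algHom_ext fun k => by simp [translate]
  exact DFunLike.congr_fun this f

theorem rename_dilate {L : Type*} (ρ : K → L) (f : MvPolynomial K ℂ) :
    dilate (rename ρ f) = rename ρ (dilate f) := by
  have : dilate.comp (rename ρ) = (rename ρ).comp (dilate (K := K)) :=
    MvPolynomial.algHom_ext fun k => by simp [dilate]
  exact DFunLike.congr_fun this f

theorem rename_diffProd [LinearOrder P] [Fintype P] {L : Type*} (ρ : K → L) (c : P → K)
    (σ : P → P) :
    rename ρ (diffProd c σ) = diffProd (ρ ∘ c) σ := by
  simp [diffProd, map_prod]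

theorem X_sub_X_ne_zero {a b : K} (h : a ≠ b) : (X a - X b : MvPolynomial K ℂ) ≠ 0 :=
  sub_ne_zero.2 fun e => h (X_injective e)

variable [DecidableEq K]

/-- The restrictions to `y_k = (x_k, 1)` of the polynomial functions on `(V^*)^K` that are
homogeneous in `y_k` of degree the number of points of `S` of colour `k`, and invariant under the
unipotent matrices and one nontrivial diagonal matrix. -/
structure IsInvariant (S : Finset P) (c : P → K) (f : MvPolynomial K ℂ) : Prop where
  degreeOf_le : ∀ k, f.degreeOf k ≤ (S.filter fun i => c i = k).card
  translate_eq : ∀ t, translate t f = f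
  dilate_eq : dilate f = C (2 ^ S.card) * f

namespace IsInvariant

variable {S : Finset P} {c : P → K} {f g : MvPolynomial K ℂ}

theorem sub (hf : IsInvariant S c f) (hg : IsInvariant S c g) : IsInvariant S c (f - g) where
  degreeOf_le k := (degreeOf_sub_le k f g).trans (max_le (hf.degreeOf_le k) (hg.degreeOf_le k))
  translate_eq t := by rw [map_sub, hf.translate_eq, hg.translate_eq]
  dilate_eq := by rw [map_sub, hf.dilate_eq, hg.dilate_eq, mul_sub]

theorem sum_smul {ι : Type*} (s : Finset ι) (a : ι → ℂ) {F : ι → MvPolynomial K ℂ}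
    (h : ∀ i ∈ s, IsInvariant S c (F i)) : IsInvariant S c (∑ i ∈ s, a i • F i) where
  degreeOf_le k := (degreeOf_sum_le k s _).trans (Finset.sup_le fun i hi => by
    rw [smul_eq_C_mul]
    exact (degreeOf_C_mul_le _ _ _).trans ((h i hi).degreeOf_le k))
  translate_eq t := by
    rw [map_sum]
    exact Finset.sum_congr rfl fun i hi => by rw [map_smul, (h i hi).translate_eq]
  dilate_eq := by
    rw [map_sum, Finset.mul_sum]
    exact Finset.sum_congr rfl fun i hi => by rw [map_smul, (h i hi).dilate_eq, mul_smul_comm]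

/-- Identifying colours preserves invariance. -/
theorem rename [Fintype K] {L : Type*} [DecidableEq L] (ρ : K → L) (h : IsInvariant S c f) :
    IsInvariant S (ρ ∘ c) (rename ρ f) where
  degreeOf_le l := by
    refine degreeOf_le_iff.2 fun e he => ?_
    obtain ⟨u, rfl, hu⟩ := coeff_rename_ne_zero ρ f e (mem_support_iff.1 he)
    have h1 : (Finsupp.mapDomain ρ u) l = ∑ k with ρ k = l, u k := by
      simp [Finsupp.mapDomain, Finsupp.sum_fintype, Finsupp.single_apply,
        Finset.sum_filter]
    have h2 : (S.filter fun i => (ρ ∘ c) i = l).card =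
        ∑ k with ρ k = l, (S.filter fun i => c i = k).card := by
      rw [Finset.card_eq_sum_card_fiberwise (f := c) (t := Finset.univ.filter fun k => ρ k = l)
        (fun i hi => by simpa using (mem_filter.1 hi).2)]
      refine Finset.sum_congr rfl fun k hk => ?_
      rw [Finset.filter_filter]
      congr 1
      refine Finset.filter_congr fun i _ => ?_
      have := (mem_filter.1 hk).2
      exact ⟨fun e => e.2, fun e => ⟨by simp [e, this], e⟩⟩
    rw [h1, h2]
    exact Finset.sum_le_sum fun k _ => degreeOf_le_iff.1 (h.degreeOf_le k) u (mem_support_iff.2 hu)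
  translate_eq t := by rw [rename_translate, h.translate_eq]
  dilate_eq := by rw [rename_dilate, h.dilate_eq, map_mul, rename_C]

/-- If all points have the same colour, there are no invariants but the constants, and those only
if there are no points. -/
theorem eq_C_of_color_eq (h : IsInvariant S c f) (hc : ∀ i ∈ S, ∀ j ∈ S, c i = c j) :
    ∃ a, f = C a ∧ (S.Nonempty → a = 0) := by
  have key : ∀ x y : K → ℂ, (∀ i ∈ S, x (c i) = y (c i)) → eval x f = eval y f :=
    fun x y hxy => by
      refine hom_congr_vars (f₁ := eval x) (f₂ := eval y) (by ext; simp) (fun k hk _ => ?_) rfl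
      rw [mem_vars_iff_degreeOf_ne_zero] at hk
      have := (Nat.pos_of_ne_zero hk).trans_le (h.degreeOf_le k)
      obtain ⟨i, hi⟩ := card_pos.1 this
      rw [mem_filter] at hi
      simpa [hi.2] using hxy i hi.1
  have hconst : ∀ x, eval x f = eval 0 f := fun x => by
    rcases S.eq_empty_or_nonempty with rfl | ⟨i, hi⟩
    · exact key _ _ (by simp)
    · -- translate the only variable that occurs to `0`
      conv_lhs => rw [← h.translate_eq (-x (c i)), eval_translate]
      exact key _ _ fun j hj => by simp [hc i hi j hj]
  have hfC : f = C (eval 0 f) := MvPolynomial.funext fun x => by rw [hconst, eval_C]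
  refine ⟨_, hfC, fun hS => ?_⟩
  have h1 := congrArg (eval 0) h.dilate_eq
  rw [eval_dilate, hconst, map_mul, eval_C] at h1
  have h2 : (2 : ℂ) ^ S.card ≠ 1 := by
    exact_mod_cast (Nat.one_lt_two_pow (card_pos.2 hS).ne').ne'
  by_contra h3
  exact h2 (mul_right_cancel₀ h3 (by rw [← h1, one_mul]))

end IsInvariant

/-- A polynomial that vanishes on setting `x_b = x_a` is divisible by `x_a - x_b`, because the two
variables have the same class modulo `x_a - x_b`. -/
theorem X_sub_X_dvd_of_rename_eq_zero {a b : K} {f : MvPolynomial K ℂ}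
    (h : rename (fun k => if k = b then a else k) f = 0) : X a - X b ∣ f := by
  rw [← Ideal.mem_span_singleton, ← Ideal.Quotient.eq_zero_iff_mem]
  set I : Ideal (MvPolynomial K ℂ) := Ideal.span {X a - X b}
  have : (Ideal.Quotient.mkₐ ℂ I).comp (rename fun k => if k = b then a else k) =
      Ideal.Quotient.mkₐ ℂ I := by
    refine MvPolynomial.algHom_ext fun k => ?_
    simp only [AlgHom.comp_apply, rename_X, Ideal.Quotient.mkₐ_eq_mk]
    split_ifs with hk
    · rw [hk, Ideal.Quotient.eq]
      exact Ideal.mem_span_singleton_self _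
    · rfl
  have h1 := DFunLike.congr_fun this f
  rw [AlgHom.comp_apply, h, map_zero] at h1
  exact h1.symm

theorem degreeOf_X_sub_X {a b : K} (h : a ≠ b) (k : K) :
    (if a = k then 1 else 0) + (if b = k then 1 else 0) =
      (X a - X b : MvPolynomial K ℂ).degreeOf k := by
  refine le_antisymm ?_ ?_
  · split_ifs with h1 h2 h2
    · exact absurd (h1.trans h2.symm) h
    · refine degreeOf_le_iff.1 (le_refl _) (Finsupp.single a 1) ?_ |>.trans' (by simp [h1])
      simp [mem_support_iff, coeff_X, Finsupp.single_left_inj, h.symm]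
    · refine degreeOf_le_iff.1 (le_refl _) (Finsupp.single b 1) ?_ |>.trans' (by simp [h2])
      simp [mem_support_iff, coeff_X, Finsupp.single_left_inj, h]
    · simp
  · refine (degreeOf_sub_le k _ _).trans ?_
    rw [degreeOf_X, degreeOf_X]
    simp only [eq_comm (a := k)]
    split_ifs <;> simp

theorem degreeOf_X_sub_X_le (a b k : K) :
    (X a - X b : MvPolynomial K ℂ).degreeOf k ≤
      (if a = k then 1 else 0) + (if b = k then 1 else 0) := by
  by_cases h : a = b
  · simp [h]
  · exact (degreeOf_X_sub_X h k).ge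

variable [LinearOrder P] {S : Finset P} {c : P → K} {p q : P}

theorem card_filter_erase_erase (hp : p ∈ S) (hq : q ∈ S) (hpq : p ≠ q) (Q : P → Prop)
    [DecidablePred Q] :
    (S.filter Q).card =
      ((if Q p then 1 else 0) + if Q q then 1 else 0) +
        (((S.erase p).erase q).filter Q).card := by
  rw [card_filter, card_filter, ← Finset.add_sum_erase S _ hp,
    ← Finset.add_sum_erase (S.erase p) _ (mem_erase.2 ⟨hpq.symm, hq⟩), add_assoc]

/-- Dividing an invariant by the difference of the variables of two points deletes these points. -/
theorem IsInvariant.of_X_sub_X_mul (hp : p ∈ S) (hq : q ∈ S) (hc : c p ≠ c q)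
    {g : MvPolynomial K ℂ} (h : IsInvariant S c ((X (c p) - X (c q)) * g)) :
    IsInvariant ((S.erase p).erase q) c g := by
  have hpq : p ≠ q := fun e => hc (by rw [e])
  have hX := X_sub_X_ne_zero hc
  refine ⟨fun k => ?_, fun t => ?_, ?_⟩
  · rcases eq_or_ne g 0 with rfl | hg
    · simp
    have h1 := h.degreeOf_le k
    rw [degreeOf_mul_eq hX hg, card_filter_erase_erase hp hq hpq, ← degreeOf_X_sub_X hc k] at h1
    omega
  · have h1 := h.translate_eq t
    rw [map_mul, translate_X_sub_X] at h1
    exact mul_left_cancel₀ hX h1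
  · have h1 := h.dilate_eq
    have h2 : S.card = 2 + ((S.erase p).erase q).card := by
      have := card_filter_erase_erase hp hq hpq fun _ => True
      simpa using this
    rw [map_mul, dilate_X_sub_X, h2, pow_add] at h1
    refine mul_left_cancel₀ (a := C (2 * 2) * (X (c p) - X (c q)))
      (mul_ne_zero (by simp) hX) ?_
    rw [h1]
    simp only [pow_two, C_mul]
    ring

variable [Fintype P]

theorem IsMatching.isInvariant_diffProd {σ : P → P} (h : IsMatching S c σ) :
    IsInvariant S c (diffProd c σ) where
  degreeOf_le k := by
    refine (degreeOf_prod_le k _ _).trans ?_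
    rw [card_filter, ← h.sum_pairs]
    exact Finset.sum_le_sum fun i _ => degreeOf_X_sub_X_le _ _ k
  translate_eq t := by
    rw [diffProd, map_prod]
    exact Finset.prod_congr rfl fun i _ => translate_X_sub_X t _ _
  dilate_eq := by
    have h1 := h.prod_pairs fun _ => (2 : ℂ)
    rw [prod_const (s := S)] at h1
    rw [diffProd, map_prod, ← h1, map_prod, ← Finset.prod_mul_distrib]
    exact Finset.prod_congr rfl fun i _ => dilate_X_sub_X _ _

end Polynomials

/-! ### The noncrossing matchings give a basis of the invariants -/

section Basis

variable {P K : Type*} [LinearOrder P] [Fintype P] {S : Finset P} {c : P → K}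

theorem IsMatching.diffProd_swap_comp {p q : P} {τ : P → P} (hlt : p < q)
    (h : IsMatching ((S.erase p).erase q) c τ) :
    diffProd c (Equiv.swap p q ∘ τ) = (X (c p) - X (c q)) * diffProd c τ := by
  have hp : τ p = p := h.eq_self (by simp)
  have hq : τ q = q := h.eq_self (by simp)
  have hp'' : (Equiv.swap p q ∘ τ) p = q := by simp [hp]
  have hq'' : (Equiv.swap p q ∘ τ) q = p := by simp [hq]
  have ho : ∀ i, i ≠ p → i ≠ q → (Equiv.swap p q ∘ τ) i = τ i := fun i h1 h2 =>
    Equiv.swap_apply_of_ne_of_ne (fun e => h1 (h.injective (e.trans hp.symm)))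
      (fun e => h2 (h.injective (e.trans hq.symm)))
  have h1 : (univ.filter fun i => i < (Equiv.swap p q ∘ τ) i) =
      insert p (univ.filter fun i => i < τ i) := by
    ext i
    rw [mem_insert, mem_filter, mem_filter]
    by_cases h1 : i = p
    · rw [h1, hp'']
      simp [hlt]
    by_cases h2 : i = q
    · rw [h2, hq'', hq]
      simp [hlt.ne', hlt.not_gt]
    · rw [ho i h1 h2]
      simp [h1]
  rw [diffProd, h1, prod_insert (by simp [hp]), hp'', diffProd]
  congr 1
  refine Finset.prod_congr rfl fun i hi => ?_
  have hi := (mem_filter.1 hi).2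
  rw [ho i (by rintro rfl; exact hi.ne hp.symm) (by rintro rfl; exact hi.ne hq.symm)]

theorem matchings_of_color_eq (hc : ∀ i ∈ S, ∀ j ∈ S, c i = c j) :
    matchings S c = if S.Nonempty then ∅ else {id} := by
  ext σ
  split_ifs with hS
  · obtain ⟨i, hi⟩ := hS
    simp only [mem_matchings, notMem_empty, iff_false]
    exact fun h => h.color i hi (hc _ (h.map_mem hi) _ hi)
  · obtain rfl := not_nonempty_iff_eq_empty.1 hS
    simp only [mem_matchings, mem_singleton]
    constructor
    · exact fun h => funext fun i => h.eq_self (by simp)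
    · rintro rfl
      exact ⟨by simp, by simp, by simp, fun i j h1 h2 => absurd h1 h2.not_gt⟩

theorem sum_swap_matchings {p q : P} (hlt : p < q) (a : (P → P) → ℂ) :
    ∑ τ ∈ matchings ((S.erase p).erase q) c,
        a (Equiv.swap p q ∘ τ) • diffProd c (Equiv.swap p q ∘ τ) =
      (X (c p) - X (c q)) *
        ∑ τ ∈ matchings ((S.erase p).erase q) c, a (Equiv.swap p q ∘ τ) • diffProd c τ := by
  rw [Finset.mul_sum]
  refine Finset.sum_congr rfl fun τ hτ => ?_
  rw [(mem_matchings.1 hτ).diffProd_swap_comp hlt, mul_smul_comm]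

variable [LinearOrder K] {p q : P}

/-- The matchings of `S` are those that remain admissible when the colours of two neighbours are
merged, together with those that arise by adding the arc between these neighbours. -/
theorem sum_matchings {M : Type*} [AddCommMonoid M] (hmono : MonotoneOn c S)
    (hpq : IsNext S p q) (hc : c p ≠ c q) (F : (P → P) → M) :
    ∑ σ ∈ matchings S c, F σ = ∑ σ ∈ matchings S (merge (c p) (c q) ∘ c), F σ +
      ∑ τ ∈ matchings ((S.erase p).erase q) c, F (Equiv.swap p q ∘ τ) := by
  rw [← Finset.sum_filter_not_add_sum_filter (matchings S c) fun σ => σ p = q]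
  congr 1
  · refine Finset.sum_congr ?_ fun _ _ => rfl
    ext σ
    rw [mem_filter, mem_matchings, mem_matchings, isMatching_merge_iff hmono hpq hc]
  · refine (Finset.sum_nbij' (fun τ => Equiv.swap p q ∘ τ) (fun σ => Equiv.swap p q ∘ σ)
      ?_ ?_ ?_ ?_ ?_).symm
    · intro τ hτ
      rw [mem_matchings] at hτ
      rw [mem_filter, mem_matchings]
      refine ⟨hτ.swap_comp hpq hc, ?_⟩
      simp [hτ.eq_self (i := p) (by simp)]
    · intro σ hσ
      rw [mem_filter, mem_matchings] at hσ
      rw [mem_matchings]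
      exact hσ.1.swap_comp_erase hσ.2
    · intro τ _
      ext i
      simp
    · intro τ _
      ext i
      simp
    · intro _ _
      rfl

/-- Setting `x_q = x_p` kills the products with a factor `x_p - x_q`. -/
theorem rename_sum_matchings (hmono : MonotoneOn c S) (hpq : IsNext S p q) (hc : c p ≠ c q)
    (a : (P → P) → ℂ) :
    rename (merge (c p) (c q)) (∑ σ ∈ matchings S c, a σ • diffProd c σ) =
      ∑ σ ∈ matchings S (merge (c p) (c q) ∘ c),
        a σ • diffProd (merge (c p) (c q) ∘ c) σ := by
  rw [sum_matchings hmono hpq hc, map_add, map_sum, map_sum]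
  simp only [map_smul]
  rw [Finset.sum_eq_zero (s := matchings ((S.erase p).erase q) c), add_zero]
  · exact Finset.sum_congr rfl fun σ _ => by rw [rename_diffProd]
  · intro τ hτ
    rw [mem_matchings] at hτ
    rw [hτ.diffProd_swap_comp hpq.lt, map_mul, map_sub, rename_X, rename_X]
    simp [merge]

/-- The products of differences attached to the noncrossing matchings are linearly independent. -/
theorem linearIndependent_diffProd (hmono : MonotoneOn c S) :
    ∀ a : (P → P) → ℂ, ∑ σ ∈ matchings S c, a σ • diffProd c σ = 0 →
      ∀ σ ∈ matchings S c, a σ = 0 := by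
  refine colored_induction (Q := fun S c => ∀ a : (P → P) → ℂ,
    ∑ σ ∈ matchings S c, a σ • diffProd c σ = 0 → ∀ σ ∈ matchings S c, a σ = 0) ?_ ?_ S c hmono
  · intro S c hc a ha σ hσ
    rw [matchings_of_color_eq hc] at ha hσ
    split_ifs at ha hσ
    · simp at hσ
    · rw [mem_singleton] at hσ
      simpa [diffProd, hσ] using ha
  · intro S c p q hmono hpq hc ih1 ih2 a ha σ hσ
    have h1 := ih1 a (by rw [← rename_sum_matchings hmono hpq hc, ha, map_zero])
    rw [sum_matchings hmono hpq hc, sum_swap_matchings hpq.lt, Finset.sum_eq_zero, zero_add] at ha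
    · have h2 := ih2 (fun τ => a (Equiv.swap p q ∘ τ))
        ((mul_eq_zero.1 ha).resolve_left (X_sub_X_ne_zero hc))
      by_cases h : σ p = q
      · have h3 := h2 (Equiv.swap p q ∘ σ)
          (mem_matchings.2 ((mem_matchings.1 hσ).swap_comp_erase h))
        have h4 : Equiv.swap p q ∘ Equiv.swap p q ∘ σ = σ := by
          ext i
          simp
        rwa [h4] at h3
      · exact h1 σ (mem_matchings.2 ((isMatching_merge_iff hmono hpq hc).2
          ⟨mem_matchings.1 hσ, h⟩))
    · intro τ hτ
      rw [h1 τ hτ, zero_smul]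

/-- The products of differences attached to the noncrossing matchings span the invariants. -/
theorem IsInvariant.exists_eq_sum [Fintype K] (hmono : MonotoneOn c S) :
    ∀ f : MvPolynomial K ℂ, IsInvariant S c f →
      ∃ a : (P → P) → ℂ, f = ∑ σ ∈ matchings S c, a σ • diffProd c σ := by
  refine colored_induction (Q := fun S c => ∀ f : MvPolynomial K ℂ, IsInvariant S c f →
      ∃ a : (P → P) → ℂ, f = ∑ σ ∈ matchings S c, a σ • diffProd c σ) ?_ ?_ S c hmono
  · intro S c hc f hf
    obtain ⟨b, rfl, hb⟩ := hf.eq_C_of_color_eq hc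
    refine ⟨fun _ => b, ?_⟩
    rw [matchings_of_color_eq hc]
    split_ifs with hS
    · simp [hb hS]
    · simp [diffProd, smul_eq_C_mul]
  · intro S c p q hmono hpq hc ih1 ih2 f hf
    obtain ⟨a, ha⟩ := ih1 _ (hf.rename (merge (c p) (c q)))
    -- subtracting the combination found for the merged colours makes `f` divisible
    -- by the difference of the two variables
    set h := ∑ σ ∈ matchings S c, a σ • diffProd c σ with hh
    have hinv : IsInvariant S c (f - h) := hf.sub
      (IsInvariant.sum_smul _ _ fun σ hσ => (mem_matchings.1 hσ).isInvariant_diffProd)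
    have hdvd : X (c p) - X (c q) ∣ f - h := by
      refine X_sub_X_dvd_of_rename_eq_zero ?_
      change MvPolynomial.rename (merge (c p) (c q)) (f - h) = 0
      rw [map_sub, ha, hh, rename_sum_matchings hmono hpq hc, sub_self]
    obtain ⟨g, hg⟩ := hdvd
    rw [hg] at hinv
    obtain ⟨b, hb⟩ := ih2 g (hinv.of_X_sub_X_mul hpq.left hpq.right hc)
    refine ⟨fun σ => a σ + if σ p = q then b (Equiv.swap p q ∘ σ) else 0, ?_⟩
    rw [eq_add_of_sub_eq hg, hb, add_comm]
    simp only [add_smul, Finset.sum_add_distrib]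
    congr 1
    rw [sum_matchings hmono hpq hc,
      Finset.sum_eq_zero (s := matchings S (merge (c p) (c q) ∘ c)), zero_add,
      sum_swap_matchings hpq.lt fun σ => if σ p = q then b (Equiv.swap p q ∘ σ) else 0]
    · congr 1
      refine Finset.sum_congr rfl fun τ hτ => ?_
      have h1 : (Equiv.swap p q ∘ τ) p = q := by
        simp [(mem_matchings.1 hτ).eq_self (i := p) (by simp)]
      have h4 : Equiv.swap p q ∘ Equiv.swap p q ∘ τ = τ := by
        ext i
        simp
      rw [if_pos h1, h4]
    · intro σ hσ
      rw [if_neg ((isMatching_merge_iff hmono hpq hc).1 (mem_matchings.1 hσ)).2, zero_smul]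

end Basis

/-! ### Coordinates on the tensor power -/

/-- The exponent of the monomial `X^k Y^(d-k)`. -/
noncomputable def expo (d : ℕ) (k : Fin (d + 1)) : Fin 2 →₀ ℕ :=
  Finsupp.single 0 (k : ℕ) + Finsupp.single 1 (d - k)

theorem expo_zero {d : ℕ} (k : Fin (d + 1)) : expo d k 0 = k := by simp [expo]

theorem expo_one {d : ℕ} (k : Fin (d + 1)) : expo d k 1 = d - k := by simp [expo]

theorem expo_injective (d : ℕ) : Function.Injective (expo d) := fun k l h => by
  have := DFunLike.congr_fun h 0
  rw [expo_zero, expo_zero] at this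
  exact Fin.ext this

theorem exists_eq_expo {d : ℕ} {p : MvPolynomial (Fin 2) ℂ} (hp : p.IsHomogeneous d)
    {e : Fin 2 →₀ ℕ} (he : p.coeff e ≠ 0) : ∃ k, e = expo d k := by
  have h : e.degree = d := by
    rw [Finsupp.degree_eq_weight_one]
    exact hp he
  rw [Finsupp.degree_eq_sum, Fin.sum_univ_two] at h
  refine ⟨⟨e 0, by omega⟩, Finsupp.ext fun i => ?_⟩
  fin_cases i
  · change e 0 = expo d _ 0
    rw [expo_zero]
  · change e 1 = expo d _ 1
    rw [expo_one]
    simp only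
    omega

/-- The basis `binom(d, k) X^k Y^(d-k)` of the space of binary forms. In these coordinates, the
form `(a X + b Y)^d` is `(a^k b^(d-k))_k`. -/
noncomputable def formBasis (d : ℕ) : Module.Basis (Fin (d + 1)) ℂ (Form d) :=
  Module.Basis.ofEquivFun <| LinearEquiv.ofBijective
    (LinearMap.pi fun k : Fin (d + 1) =>
      ((d.choose k : ℂ)⁻¹ • (lcoeff ℂ (expo d k)) ∘ₗ (homogeneousSubmodule (Fin 2) ℂ d).subtype) :
        Form d →ₗ[ℂ] Fin (d + 1) → ℂ) (by
    have hch : ∀ k : Fin (d + 1), (d.choose k : ℂ) ≠ 0 := fun k =>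
      Nat.cast_ne_zero.2 (Nat.choose_pos (Nat.lt_succ_iff.1 k.2)).ne'
    constructor
    · rw [injective_iff_map_eq_zero]
      intro p hp
      refine Subtype.ext (MvPolynomial.ext _ _ fun e => ?_)
      by_contra he
      obtain ⟨k, rfl⟩ := exists_eq_expo p.2 he
      have := congrFun hp k
      simp only [LinearMap.pi_apply, LinearMap.smul_apply, LinearMap.comp_apply,
        Submodule.subtype_apply, lcoeff_apply, smul_eq_mul, Pi.zero_apply, mul_eq_zero,
        inv_eq_zero, hch, false_or] at this
      exact he (by simpa using this)
    · intro a
      refine ⟨⟨∑ k, monomial (expo d k) (d.choose k * a k), ?_⟩, ?_⟩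
      · refine Submodule.sum_mem _ fun k _ => ?_
        refine isHomogeneous_monomial _ ?_
        rw [Finsupp.degree_eq_sum, Fin.sum_univ_two, expo_zero, expo_one]
        omega
      · ext k
        simp [coeff_monomial, (expo_injective d).eq_iff, hch])

theorem formBasis_repr_symmProd {d : ℕ} (y : Module.Dual ℂ V) (k : Fin (d + 1)) :
    (formBasis d).repr (symmProd fun _ => y) k =
      y (Pi.single 0 1) ^ (k : ℕ) * y (Pi.single 1 1) ^ (d - k) := by
  have hch : (d.choose k : ℂ) ≠ 0 :=
    Nat.cast_ne_zero.2 (Nat.choose_pos (Nat.lt_succ_iff.1 k.2)).ne'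
  change (d.choose k : ℂ)⁻¹ * coeff (expo d k) (∏ j : Fin d, linearPoly y) = _
  have hterm : ∀ n ∈ range (d + 1), (C (y (Pi.single 0 1)) * X 0) ^ n *
      (C (y (Pi.single 1 1)) * X 1) ^ (d - n) * (d.choose n : MvPolynomial (Fin 2) ℂ) =
      monomial (Finsupp.single 0 n + Finsupp.single 1 (d - n))
        (y (Pi.single 0 1) ^ n * y (Pi.single 1 1) ^ (d - n) * d.choose n) := fun n _ => by
    rw [show (d.choose n : MvPolynomial (Fin 2) ℂ) = C (d.choose n : ℂ) by simp, mul_pow, mul_pow,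
      X_pow_eq_monomial, X_pow_eq_monomial, ← C_pow, ← C_pow, C_mul_monomial, C_mul_monomial,
      monomial_mul, mul_comm, C_mul_monomial]
    congr 1
    ring
  rw [prod_const, card_univ, Fintype.card_fin, linearPoly, Fin.sum_univ_two, add_pow,
    Finset.sum_congr rfl hterm, Finset.sum_range, coeff_sum, Finset.sum_eq_single k]
  · rw [← expo, coeff_monomial, if_pos rfl]
    field_simp
  · intro l _ hl
    rw [← expo, coeff_monomial, if_neg fun e => hl (expo_injective d e)]
  · simp

/-- The basis of the tensor power dual to the monomial basis of the space of forms. -/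
noncomputable def polyBasis (m d : ℕ) : Module.Basis (Fin m → Fin (d + 1)) ℂ (NCPoly m d) :=
  Basis.piTensorProduct fun _ => (formBasis d).dualBasis

theorem diagSymbol_polyBasis {m d : ℕ} (k : Fin m → Fin (d + 1)) (y : Fin m → Module.Dual ℂ V) :
    diagSymbol m d (polyBasis m d k) y =
      ∏ i, (y i (Pi.single 0 1) ^ (k i : ℕ) * y i (Pi.single 1 1) ^ (d - k i)) := by
  change PiTensorProduct.dualDistrib (polyBasis m d k) _ = _
  rw [polyBasis, Basis.piTensorProduct_apply, PiTensorProduct.dualDistrib_apply]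
  refine Finset.prod_congr rfl fun i _ => ?_
  rw [Module.Basis.coe_dualBasis, Module.Basis.coord_apply, formBasis_repr_symmProd]

theorem diagSymbol_apply {m d : ℕ} (F : NCPoly m d) (y : Fin m → Module.Dual ℂ V) :
    diagSymbol m d F y = ∑ k, (polyBasis m d).repr F k *
      ∏ i, (y i (Pi.single 0 1) ^ (k i : ℕ) * y i (Pi.single 1 1) ^ (d - k i)) := by
  conv_lhs => rw [← (polyBasis m d).sum_repr F, map_sum, Finset.sum_apply]
  exact Finset.sum_congr rfl fun k _ => by
    rw [map_smul, Pi.smul_apply, diagSymbol_polyBasis, smul_eq_mul]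

/-- The linear form with coordinates `(a, b)`. -/
noncomputable def linForm (a b : ℂ) : Module.Dual ℂ V :=
  a • LinearMap.proj 0 + b • LinearMap.proj 1

@[simp]
theorem linForm_single_zero (a b : ℂ) : linForm a b (Pi.single 0 1) = a := by
  simp [linForm]

@[simp]
theorem linForm_single_one (a b : ℂ) : linForm a b (Pi.single 1 1) = b := by
  simp [linForm]

theorem linForm_eq (y : Module.Dual ℂ V) :
    linForm (y (Pi.single 0 1)) (y (Pi.single 1 1)) = y := by
  refine LinearMap.pi_ext' fun i => LinearMap.ext_ring ?_
  fin_cases i <;> simp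

theorem bracket_eq (y z : Module.Dual ℂ V) :
    bracket y z = y (Pi.single 0 1) * z (Pi.single 1 1) -
      y (Pi.single 1 1) * z (Pi.single 0 1) := by
  rw [bracket, Matrix.det_fin_two_of]
  ring

/-- The exponent vector with entries `k i`. -/
noncomputable def multiExpo {m d : ℕ} (k : Fin m → Fin (d + 1)) : Fin m →₀ ℕ :=
  Finsupp.equivFunOnFinite.symm fun i => (k i : ℕ)

theorem multiExpo_injective (m d : ℕ) :
    Function.Injective (multiExpo : (Fin m → Fin (d + 1)) → _) := fun k l h => by
  funext i
  exact Fin.ext (by simpa [multiExpo] using DFunLike.congr_fun h i)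

/-- The restriction of the symbol to the linear forms `y_i = (x_i, 1)`, as a polynomial in `x`. -/
noncomputable def affineSymbol (m d : ℕ) : NCPoly m d →ₗ[ℂ] MvPolynomial (Fin m) ℂ :=
  (polyBasis m d).constr ℂ fun k => monomial (multiExpo k) 1

theorem affineSymbol_apply {m d : ℕ} (F : NCPoly m d) :
    affineSymbol m d F = ∑ k, monomial (multiExpo k) ((polyBasis m d).repr F k) := by
  rw [affineSymbol, Module.Basis.constr_apply_fintype]
  simp [smul_monomial, Module.Basis.equivFun_apply]

theorem coeff_affineSymbol {m d : ℕ} (F : NCPoly m d) (k : Fin m → Fin (d + 1)) :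
    coeff (multiExpo k) (affineSymbol m d F) = (polyBasis m d).repr F k := by
  simp [affineSymbol_apply, coeff_sum, coeff_monomial, (multiExpo_injective m d).eq_iff]

theorem affineSymbol_injective (m d : ℕ) : Function.Injective (affineSymbol m d) := by
  intro F F' h
  refine (polyBasis m d).ext_elem fun k => ?_
  rw [← coeff_affineSymbol, h, coeff_affineSymbol]

theorem degreeOf_affineSymbol_le {m d : ℕ} (F : NCPoly m d) (i : Fin m) :
    (affineSymbol m d F).degreeOf i ≤ d := by
  rw [affineSymbol_apply]
  refine (degreeOf_sum_le _ _ _).trans (Finset.sup_le fun k _ => degreeOf_le_iff.2 fun e he => ?_)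
  rw [Finset.mem_singleton.1 (support_monomial_subset he)]
  simpa [multiExpo] using Nat.lt_succ_iff.1 (k i).2

/-- Every polynomial of degree at most `d` in each variable is the restriction of a symbol. -/
theorem exists_affineSymbol_eq {m d : ℕ} {f : MvPolynomial (Fin m) ℂ}
    (hf : ∀ i, f.degreeOf i ≤ d) : ∃ F, affineSymbol m d F = f := by
  refine ⟨∑ k, coeff (multiExpo k) f • polyBasis m d k, MvPolynomial.ext _ _ fun e => ?_⟩
  by_cases he : ∀ i, e i ≤ d
  · have : e = multiExpo fun i => (⟨e i, Nat.lt_succ_iff.2 (he i)⟩ : Fin (d + 1)) := by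
      ext i
      simp [multiExpo]
    rw [this, coeff_affineSymbol, Module.Basis.repr_sum_self]
  · obtain ⟨i, hi⟩ := not_forall.1 he
    have key : ∀ g : MvPolynomial (Fin m) ℂ, g.degreeOf i ≤ d → coeff e g = 0 := fun g hg => by
      by_contra h
      exact hi (degreeOf_le_iff.1 hg e (mem_support_iff.2 h))
    rw [key _ (degreeOf_affineSymbol_le _ i), key _ (hf i)]

/-- Homogenization recovers the symbol from its restriction to the linear forms `(x, 1)`. -/
theorem diagSymbol_linForm {m d : ℕ} (F : NCPoly m d) (x b : Fin m → ℂ) :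
    diagSymbol m d F (fun i => linForm (b i * x i) (b i)) =
      (∏ i, b i ^ d) * eval x (affineSymbol m d F) := by
  rw [diagSymbol_apply, affineSymbol_apply, map_sum, Finset.mul_sum]
  refine Finset.sum_congr rfl fun k _ => ?_
  rw [eval_monomial, mul_left_comm, Finsupp.prod_fintype _ _ (by simp), ← Finset.prod_mul_distrib]
  congr 1
  refine Finset.prod_congr rfl fun i _ => ?_
  have : b i ^ d = b i ^ (k i : ℕ) * b i ^ (d - k i) := by
    rw [← pow_add, Nat.add_sub_cancel' (Nat.lt_succ_iff.1 (k i).2)]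
  simp only [linForm_single_zero, linForm_single_one, this, mul_pow, multiExpo,
    Finsupp.equivFunOnFinite_symm_apply_apply]
  ring

theorem diagSymbol_injective (m d : ℕ) : Function.Injective (diagSymbol m d) := by
  rw [← LinearMap.ker_eq_bot, LinearMap.ker_eq_bot']
  intro F hF
  apply affineSymbol_injective m d
  refine MvPolynomial.funext fun x => ?_
  have := diagSymbol_linForm F x 1
  rw [hF] at this
  simpa using this.symm

/-! ### Equivariance of the symbol -/

/-- The element `g⁻¹` takes the linear form `y` to `v ↦ y (g v)`. -/
theorem substAlgHom_linearPoly (g : G) (y : Module.Dual ℂ V) :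
    substAlgHom g⁻¹ (linearPoly y) = linearPoly (y ∘ₗ Matrix.toLin' g.1) := by
  have h : ∀ z : Module.Dual ℂ V, ∀ v, eval v (linearPoly z) = z v := fun z v => by
    conv_rhs => rw [← linForm_eq z]
    simp [linearPoly, linForm, Fin.sum_univ_two]
  refine MvPolynomial.funext fun v => ?_
  rw [eval_substAlgHom, h, h, inv_inv]
  simp

theorem formRep_inv_symmProd {d : ℕ} (g : G) (y : Module.Dual ℂ V) :
    formRep d g⁻¹ (symmProd fun _ => y) = symmProd fun _ => y ∘ₗ Matrix.toLin' g.1 := by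
  refine Subtype.ext ?_
  change substAlgHom g⁻¹ (∏ j : Fin d, linearPoly y) = ∏ j : Fin d, _
  rw [map_prod]
  exact Finset.prod_congr rfl fun _ _ => substAlgHom_linearPoly g y

theorem diagSymbol_tensorRep {m d : ℕ} (g : G) (F : NCPoly m d) (y : Fin m → Module.Dual ℂ V) :
    diagSymbol m d (tensorRep m d g F) y =
      diagSymbol m d F fun i => y i ∘ₗ Matrix.toLin' g.1 := by
  change PiTensorProduct.dualDistrib (PiTensorProduct.map (fun _ => (formRep d).dual g) F)
      (PiTensorProduct.tprod ℂ fun i => symmProd fun _ => y i) =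
    PiTensorProduct.dualDistrib F
      (PiTensorProduct.tprod ℂ fun i => symmProd fun _ => y i ∘ₗ Matrix.toLin' g.1)
  induction F using PiTensorProduct.induction_on with
  | smul_tprod r f =>
    simp only [map_smul, LinearMap.smul_apply, PiTensorProduct.map_tprod,
      PiTensorProduct.dualDistrib_apply]
    congr 1
    refine Finset.prod_congr rfl fun i _ => ?_
    rw [← formRep_inv_symmProd]
    rfl
  | add F F' h h' => simp only [map_add, LinearMap.add_apply, h, h']

theorem mem_invariantPolys_iff {m d : ℕ} {F : NCPoly m d} :
    F ∈ invariantPolys m d ↔ ∀ (g : G) (y : Fin m → Module.Dual ℂ V),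
      diagSymbol m d F (fun i => y i ∘ₗ Matrix.toLin' g.1) = diagSymbol m d F y := by
  rw [Representation.mem_invariants]
  refine forall_congr' fun g => ?_
  rw [← (diagSymbol_injective m d).eq_iff, funext_iff]
  exact forall_congr' fun y => by rw [diagSymbol_tensorRep]

theorem linForm_comp (a b : ℂ) (M : Matrix (Fin 2) (Fin 2) ℂ) :
    linForm a b ∘ₗ Matrix.toLin' M =
      linForm (a * M 0 0 + b * M 1 0) (a * M 0 1 + b * M 1 1) := by
  rw [← linForm_eq (linForm a b ∘ₗ Matrix.toLin' M)]
  simp [linForm]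

theorem bracket_comp (y z : Module.Dual ℂ V) (g : G) :
    bracket (y ∘ₗ Matrix.toLin' g.1) (z ∘ₗ Matrix.toLin' g.1) = bracket y z := by
  have hdet := g.2
  rw [Matrix.det_fin_two] at hdet
  rw [← linForm_eq y, ← linForm_eq z, linForm_comp, linForm_comp]
  simp only [bracket_eq, linForm_single_zero, linForm_single_one]
  linear_combination (y (Pi.single 0 1) * z (Pi.single 1 1) -
      y (Pi.single 1 1) * z (Pi.single 0 1)) * hdet

/-! ### Pair partitions as involutions -/

section PairPartitions

variable {n : ℕ} {π π' : SetPartition n}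

theorem rel_iff_mem_part {i j : Fin n} : Rel π i j ↔ j ∈ π.part i := by
  constructor
  · rintro ⟨B, hB, hi, hj⟩
    rwa [π.part_eq_of_mem hB hi]
  · exact fun h => ⟨_, π.part_mem.2 (mem_univ i), π.mem_part (mem_univ i), h⟩

theorem IsPairPartition.exists_partner (h : IsPairPartition π) (i : Fin n) :
    ∃ k, k ≠ i ∧ ∀ j, Rel π i j ↔ j = i ∨ j = k := by
  obtain ⟨a, b, hab, hB⟩ := card_eq_two.1 (h _ (π.part_mem.2 (mem_univ i)))
  have hi := π.mem_part (mem_univ i)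
  simp only [rel_iff_mem_part, hB, mem_insert, mem_singleton] at hi ⊢
  rcases hi with rfl | rfl
  · exact ⟨b, hab.symm, fun j => Iff.rfl⟩
  · exact ⟨a, hab, fun j => or_comm⟩

/-- The involution that exchanges the two points of each block of a pair partition. -/
noncomputable def IsPairPartition.partner (h : IsPairPartition π) (i : Fin n) : Fin n :=
  (h.exists_partner i).choose

theorem IsPairPartition.partner_ne (h : IsPairPartition π) (i : Fin n) : h.partner i ≠ i :=
  (h.exists_partner i).choose_spec.1

theorem IsPairPartition.rel_iff (h : IsPairPartition π) (i j : Fin n) :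
    Rel π i j ↔ j = i ∨ j = h.partner i :=
  (h.exists_partner i).choose_spec.2 j

theorem rel_symm {i j : Fin n} (h : Rel π i j) : Rel π j i := by
  obtain ⟨B, hB, hi, hj⟩ := h
  exact ⟨B, hB, hj, hi⟩

theorem IsPairPartition.partner_partner (h : IsPairPartition π) (i : Fin n) :
    h.partner (h.partner i) = i :=
  (((h.rel_iff _ _).1 (rel_symm ((h.rel_iff i _).2 (.inr rfl)))).resolve_left
    (h.partner_ne i).symm).symm

theorem setPartition_ext (h : ∀ i j, Rel π i j ↔ Rel π' i j) : π = π' := by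
  have key : ∀ π₁ π₂ : SetPartition n, (∀ i j, Rel π₁ i j ↔ Rel π₂ i j) →
      π₁.parts ⊆ π₂.parts := fun π₁ π₂ h B hB => by
    obtain ⟨i, hi⟩ := π₁.nonempty_of_mem_parts hB
    have : B = π₂.part i := by
      ext j
      rw [← rel_iff_mem_part, ← h, rel_iff_mem_part, π₁.part_eq_of_mem hB hi]
    rw [this]
    exact π₂.part_mem.2 (mem_univ i)
  exact Finpartition.ext ((key _ _ h).antisymm (key _ _ fun i j => (h i j).symm))

end PairPartitions

namespace NCPairing

variable {m d : ℕ}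

/-- The matching of all points given by an `m`-partite noncrossing pair partition. -/
noncomputable def matching (π : NCPairing m d) : Fin (m * d) → Fin (m * d) := π.2.1.partner

theorem isMatching (π : NCPairing m d) : IsMatching univ Fin.divNat π.matching where
  invol := π.2.1.partner_partner
  mem_iff i := ⟨fun _ => π.2.1.partner_ne i, fun _ => mem_univ i⟩
  color i _ h := by
    obtain ⟨B, hB, h1, h2⟩ := (π.2.1.rel_iff i _).2 (.inr rfl)
    exact π.2.1.partner_ne i (π.2.2.1 B hB _ h2 _ h1 h)
  nested i j hij hj := by
    by_contra h
    refine π.2.2.2 ⟨i, j, π.matching i, π.matching j, hij, hj, not_le.1 h,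
      (π.2.1.rel_iff _ _).2 (.inr rfl), (π.2.1.rel_iff _ _).2 (.inr rfl), fun h' => ?_⟩
    exact ((π.2.1.rel_iff _ _).1 h').elim hij.ne' hj.ne

theorem matching_injective : Function.Injective (matching : NCPairing m d → _) := by
  intro π π' h
  refine Subtype.ext (setPartition_ext fun i j => ?_)
  rw [π.2.1.rel_iff, π'.2.1.rel_iff]
  exact or_congr_right (by rw [show π.2.1.partner i = π'.2.1.partner i from congrFun h i])

theorem exists_matching_eq {σ : Fin (m * d) → Fin (m * d)}
    (h : IsMatching univ Fin.divNat σ) : ∃ π : NCPairing m d, π.matching = σ := by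
  classical
  let s : Setoid (Fin (m * d)) :=
    { r := fun i j => j = i ∨ j = σ i
      iseqv :=
        { refl := fun i => .inl rfl
          symm := by
            rintro i j (rfl | rfl)
            · exact .inl rfl
            · exact .inr (h.invol i).symm
          trans := by
            rintro i j k (rfl | rfl) (rfl | rfl)
            · exact .inl rfl
            · exact .inr rfl
            · exact .inr rfl
            · exact .inl (h.invol i) } }
  let π : SetPartition (m * d) := Finpartition.ofSetoid s
  have hne : ∀ i, σ i ≠ i := fun i => (h.mem_iff i).1 (mem_univ i)
  have hrel : ∀ i j, Rel π i j ↔ j = i ∨ j = σ i := fun i j => by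
    rw [rel_iff_mem_part, Finpartition.mem_part_ofSetoid_iff_rel]
    rfl
  have hpair : IsPairPartition π := fun B hB => by
    obtain ⟨i, hi⟩ := π.nonempty_of_mem_parts hB
    have : B = {i, σ i} := by
      ext j
      rw [← π.part_eq_of_mem hB hi, ← rel_iff_mem_part, hrel, mem_insert, mem_singleton]
    rw [this, card_pair (hne i).symm]
  refine ⟨⟨π, hpair, fun B hB i hi j hj hij => ?_, ?_⟩, ?_⟩
  · rcases (hrel i j).1 ⟨B, hB, hi, hj⟩ with e | e
    · exact e.symm
    · exact absurd (e ▸ hij).symm (h.color i (mem_univ i))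
  · rintro ⟨i, j, k, l, hij, hjk, hkl, hik, hjl, hn⟩
    obtain rfl := ((hrel i k).1 hik).resolve_left (hij.trans hjk).ne'
    obtain rfl := ((hrel j l).1 hjl).resolve_left (hjk.trans hkl).ne'
    exact hkl.not_ge (h.nested i j hij hjk)
  · funext i
    exact ((hrel i _).1 ((hpair.rel_iff i _).2 (.inr rfl))).resolve_left (hpair.partner_ne i)

theorem range_matching :
    Set.range (matching : NCPairing m d → _) =
      (matchings univ Fin.divNat : Finset (Fin (m * d) → Fin (m * d))) := by
  ext σ
  rw [mem_coe, mem_matchings]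
  constructor
  · rintro ⟨π, rfl⟩
    exact π.isMatching
  · exact exists_matching_eq

instance : Finite (NCPairing m d) := Finite.of_injective _ matching_injective

theorem pairingSymbol_eq (π : NCPairing m d) (y : Fin m → Module.Dual ℂ V) :
    pairingSymbol π.1 y =
      ∏ i with i < π.matching i, bracket (y i.divNat) (y (π.matching i).divNat) := by
  refine Finset.prod_nbij' (fun e => e.1) (fun i => (i, π.matching i)) ?_ ?_ ?_ ?_ ?_
  · rintro ⟨i, j⟩ he
    simp only [mem_filter, mem_univ, true_and] at he ⊢
    have : j = π.matching i := ((π.2.1.rel_iff i j).1 he.2).resolve_left he.1.ne'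
    exact this ▸ he.1
  · intro i hi
    simp only [mem_filter, mem_univ, true_and] at hi ⊢
    exact ⟨hi, (π.2.1.rel_iff _ _).2 (.inr rfl)⟩
  · rintro ⟨i, j⟩ he
    simp only [mem_filter, mem_univ, true_and] at he ⊢
    have : j = π.matching i := ((π.2.1.rel_iff i j).1 he.2).resolve_left he.1.ne'
    rw [this]
  · intro i _
    rfl
  · rintro ⟨i, j⟩ he
    simp only [mem_filter, mem_univ, true_and] at he ⊢
    have : j = π.matching i := ((π.2.1.rel_iff i j).1 he.2).resolve_left he.1.ne'
    rw [this]

end NCPairing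

@[to_additive]
theorem prod_comp_interval {M : Type*} [CommMonoid M] {m d : ℕ} (g : Fin m → M) :
    ∏ p : Fin (m * d), g p.divNat = ∏ i, g i ^ d := by
  rw [← Equiv.prod_comp finProdFinEquiv.symm.symm, Fintype.prod_prod_type]
  refine Finset.prod_congr rfl fun i _ => ?_
  have : ∀ j : Fin d, (finProdFinEquiv (i, j)).divNat = i := fun j =>
    congrArg Prod.fst (finProdFinEquiv.symm_apply_apply (i, j))
  simp [this]

theorem card_filter_divNat {m d : ℕ} (k : Fin m) :
    (univ.filter fun p : Fin (m * d) => p.divNat = k).card = d := by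
  rw [card_filter, sum_comp_interval fun i => if i = k then 1 else 0]
  simp

theorem monotone_divNat (m d : ℕ) : Monotone (Fin.divNat : Fin (m * d) → Fin m) :=
  fun _ _ h => Nat.div_le_div_right h

/-! ### The basis of invariants -/

section Invariants

variable {m d : ℕ}

/-- The two families of matrices used here already cut out the invariants; the remaining elements of
`SL(2, ℂ)` are not needed. -/
theorem isInvariant_affineSymbol {F : NCPoly m d} (hF : F ∈ invariantPolys m d) :
    IsInvariant (univ : Finset (Fin (m * d))) Fin.divNat (affineSymbol m d F) where
  degreeOf_le k := by
    rw [card_filter_divNat]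
    exact degreeOf_affineSymbol_le F k
  translate_eq t := by
    refine MvPolynomial.funext fun x => ?_
    have h := mem_invariantPolys_iff.1 hF ⟨!![1, 0; t, 1], by simp⟩ fun i => linForm (x i) 1
    have h1 := diagSymbol_linForm F x 1
    have h2 := diagSymbol_linForm F (fun i => x i + t) 1
    simp only [linForm_comp] at h
    simp only [Pi.one_apply, one_mul, one_pow, prod_const_one] at h1 h2
    rw [eval_translate, ← h1, ← h2, ← h]
    simp
  dilate_eq := by
    refine MvPolynomial.funext fun x => ?_
    have h := mem_invariantPolys_iff.1 hF ⟨!![2, 0; 0, 2⁻¹], by simp⟩ fun i => linForm (x i) 1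
    have h1 := diagSymbol_linForm F x 1
    have h2 := diagSymbol_linForm F (fun i => 4 * x i) fun _ => 2⁻¹
    have h3 : ∀ i, (2 : ℂ)⁻¹ * (4 * x i) = x i * 2 := fun i => by ring
    simp only [linForm_comp] at h
    simp only [Pi.one_apply, one_mul, one_pow, prod_const_one] at h1
    simp only [h3, prod_const, card_univ, Fintype.card_fin] at h2
    simp only [Matrix.of_apply, Matrix.cons_val', Matrix.cons_val_zero, Matrix.cons_val_one,
      Matrix.cons_val_fin_one, mul_zero, add_zero, zero_add, one_mul] at h
    rw [eval_dilate, map_mul, eval_C, ← h1, ← h, h2, card_univ, Fintype.card_fin, ← pow_mul,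
      mul_comm d m, inv_pow, mul_inv_cancel_left₀ (by simp)]

theorem pairingSymbol_linForm (π : NCPairing m d) (x b : Fin m → ℂ) :
    pairingSymbol π.1 (fun i => linForm (b i * x i) (b i)) =
      (∏ i, b i ^ d) * eval x (diffProd Fin.divNat π.matching) := by
  rw [NCPairing.pairingSymbol_eq, ← prod_comp_interval, ← π.isMatching.prod_pairs, diffProd,
    map_prod, ← Finset.prod_mul_distrib]
  refine Finset.prod_congr rfl fun i _ => ?_
  simp only [bracket_eq, linForm_single_zero, linForm_single_one, map_sub, eval_X]
  ring

/-- An element whose symbol agrees with that of `π` on the linear forms `(x, 1)` has the same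
symbol as `π`. -/
theorem diagSymbol_eq_pairingSymbol (π : NCPairing m d) {F : NCPoly m d}
    (hF : affineSymbol m d F = diffProd Fin.divNat π.matching) :
    diagSymbol m d F = pairingSymbol π.1 := by
  funext y
  have hlin : ∀ a b : Fin m → ℂ, (∀ i, b i ≠ 0) →
      diagSymbol m d F (fun i => linForm (a i) (b i)) =
        pairingSymbol π.1 fun i => linForm (a i) (b i) := fun a b hb => by
    have h1 := diagSymbol_linForm F (fun i => a i / b i) b
    have h2 := pairingSymbol_linForm π (fun i => a i / b i) b
    have h3 : ∀ i, b i * (a i / b i) = a i := fun i => mul_div_cancel₀ _ (hb i)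
    simp only [h3] at h1 h2
    rw [h1, h2, hF]
  set a : Fin m → ℂ := fun i => y i (Pi.single 0 1)
  set b : Fin m → ℂ := fun i => y i (Pi.single 1 1)
  -- moving along the line `b + t`, the second coordinates are nonzero for almost all `t`
  have hdense : Dense (Set.range fun i => -b i)ᶜ :=
    (Set.finite_range _).countable.dense_compl ℂ
  have hcont1 : Continuous fun t : ℂ => diagSymbol m d F fun i => linForm (a i) (b i + t) := by
    simp only [diagSymbol_apply, linForm_single_zero, linForm_single_one]
    fun_prop
  have hcont2 : Continuous fun t : ℂ => pairingSymbol π.1 fun i => linForm (a i) (b i + t) := by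
    simp only [NCPairing.pairingSymbol_eq, bracket_eq, linForm_single_zero, linForm_single_one]
    fun_prop
  have h := congrFun (hcont1.ext_on hdense hcont2 fun t ht => hlin a (fun i => b i + t)
    fun i hi => ht ⟨i, (eq_neg_of_add_eq_zero_right hi).symm⟩) 0
  simpa only [add_zero, a, b, linForm_eq] using h

/-- Every product of brackets attached to a noncrossing pair partition is the symbol of an
invariant. -/
theorem exists_invariant_affineSymbol_eq (π : NCPairing m d) : ∃ F : invariantPolys m d,
    affineSymbol m d F.1 = diffProd Fin.divNat π.matching := by
  obtain ⟨F, hF⟩ := exists_affineSymbol_eq (m := m) (d := d)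
    (f := diffProd Fin.divNat π.matching) fun i =>
      (π.isMatching.isInvariant_diffProd.degreeOf_le i).trans (card_filter_divNat i).le
  refine ⟨⟨F, mem_invariantPolys_iff.2 fun g y => ?_⟩, hF⟩
  rw [diagSymbol_eq_pairingSymbol π hF, NCPairing.pairingSymbol_eq, NCPairing.pairingSymbol_eq]
  exact Finset.prod_congr rfl fun i _ => bracket_comp _ _ g

theorem linearIndependent_diffProd_matching (m d : ℕ) : LinearIndependent ℂ
    fun π : NCPairing m d => diffProd (Fin.divNat : Fin (m * d) → Fin m) π.matching := by
  have h : LinearIndepOn ℂ (diffProd (Fin.divNat : Fin (m * d) → Fin m))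
      (Set.range (NCPairing.matching : NCPairing m d → Fin (m * d) → Fin (m * d))) := by
    rw [NCPairing.range_matching, linearIndepOn_finset_iff]
    exact linearIndependent_diffProd ((monotone_divNat m d).monotoneOn _)
  exact (linearIndepOn_range_iff NCPairing.matching_injective
    (diffProd (Fin.divNat : Fin (m * d) → Fin m))).1 h

theorem affineSymbol_mem_span {F : NCPoly m d} (hF : F ∈ invariantPolys m d) :
    affineSymbol m d F ∈ Submodule.span ℂ (Set.range fun π : NCPairing m d =>
      diffProd (Fin.divNat : Fin (m * d) → Fin m) π.matching) := by
  obtain ⟨a, ha⟩ := IsInvariant.exists_eq_sum ((monotone_divNat m d).monotoneOn _) _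
    (isInvariant_affineSymbol hF)
  rw [ha]
  refine Submodule.sum_mem _ fun σ hσ => Submodule.smul_mem _ _ ?_
  obtain ⟨π, rfl⟩ := NCPairing.exists_matching_eq (mem_matchings.1 hσ)
  exact Submodule.subset_span ⟨π, rfl⟩

theorem exists_basis_invariantPolys (m d : ℕ) :
    ∃ b : Module.Basis (NCPairing m d) ℂ (invariantPolys m d),
      ∀ π, diagSymbol m d (b π : NCPoly m d) = pairingSymbol π.1 := by
  choose F hF using fun π : NCPairing m d => exists_invariant_affineSymbol_eq π
  let A : invariantPolys m d →ₗ[ℂ] MvPolynomial (Fin m) ℂ :=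
    affineSymbol m d ∘ₗ (invariantPolys m d).subtype
  have hA : (A ∘ F) = fun π => diffProd Fin.divNat π.matching := funext hF
  have hli : LinearIndependent ℂ F :=
    .of_comp A (hA ▸ linearIndependent_diffProd_matching m d)
  have hspan : ⊤ ≤ Submodule.span ℂ (Set.range F) := fun f _ => by
    have h := affineSymbol_mem_span f.2
    rw [← hA, Set.range_comp, Submodule.span_image] at h
    obtain ⟨f', hf', e⟩ := h
    rwa [← Subtype.ext (affineSymbol_injective m d e)]
  refine ⟨Module.Basis.mk hli hspan, fun π => ?_⟩
  rw [Module.Basis.mk_apply]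
  exact diagSymbol_eq_pairingSymbol π (hF π)

theorem rank_linearIndependent_span {ι R M N : Type*} [Finite ι] [CommRing R] [Nontrivial R]
    [AddCommGroup M] [Module R M] [AddCommGroup N] [Module R N] {W : Submodule R M}
    (b : Module.Basis ι R W) {D : M →ₗ[R] N} (hD : Function.Injective D) :
    Module.rank R W = (Nat.card ι : Cardinal) ∧ LinearIndependent R (fun i => D (b i : M)) ∧
      Submodule.span R (Set.range fun i => D (b i : M)) = W.map D := by
  have hB : (fun i => D (b i : M)) = (D ∘ₗ W.subtype) ∘ b := rfl
  refine ⟨?_, ?_, ?_⟩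
  · have := Fintype.ofFinite ι
    rw [rank_eq_card_basis b, Nat.card_eq_fintype_card]
  · rw [hB]
    exact b.linearIndependent.map' _ (LinearMap.ker_eq_bot.2 (hD.comp Subtype.val_injective))
  · rw [hB, Set.range_comp, Submodule.span_image, b.span_eq, Submodule.map_top,
      LinearMap.range_comp, Submodule.range_subtype]

end Invariants

end BinaryForms

theorem mainTheorem1 (m d : ℕ) :
    Module.rank ℂ (BinaryForms.invariantPolys m d) =
        (Nat.card (BinaryForms.NCPairing m d) : Cardinal) ∧
      LinearIndependent ℂ (fun π : BinaryForms.NCPairing m d =>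
        (BinaryForms.pairingSymbol π.1 : (Fin m → Module.Dual ℂ BinaryForms.V) → ℂ)) ∧
      Submodule.span ℂ (Set.range fun π : BinaryForms.NCPairing m d =>
          (BinaryForms.pairingSymbol π.1 : (Fin m → Module.Dual ℂ BinaryForms.V) → ℂ)) =
        (BinaryForms.invariantPolys m d).map (BinaryForms.diagSymbol m d) ∧
      ∃ b : Module.Basis (BinaryForms.NCPairing m d) ℂ (BinaryForms.invariantPolys m d),
        ∀ π : BinaryForms.NCPairing m d,
          BinaryForms.diagSymbol m d (b π : BinaryForms.NCPoly m d) =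
            BinaryForms.pairingSymbol π.1 := by
  obtain ⟨b, hb⟩ := BinaryForms.exists_basis_invariantPolys m d
  have h := BinaryForms.rank_linearIndependent_span b (BinaryForms.diagSymbol_injective m d)
  simp only [hb] at h
  exact ⟨h.1, h.2.1, h.2.2, b, hb⟩
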